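/- Let $X$ be a Polish space and $f\colon X\to X$ a continuous map. Let $C(X)$ be the space of nonempty compact subsets of $X$ with the Hausdorff metric (Vietoris) topology, and let $Q\subset C(X)$ be a $G_\delta$ subset that is hereditary, i.e. if $A\in Q$ then every nonempty compact subset of $A$ belongs to $Q$. For $n\ge 1$ let $R_n^Q$ be the set of $(x_1,\dots,x_n)\in X^n$ with $\{x_1,\dots,x_n\}\in Q$, and $\alpha_Q=\{R_n^Q\}_{n\ge 1}$. A set $B\subset X$ is called $\alpha_Q$-dependent if $(x_1,\dots,x_n)\in R_n^Q$ for all $n\ge1$ and all pairwise distinct $x_1,\dots,x_n\in B$, and $f$-invariant if $f(B)\subset B$. A Cantor set is a subset of $X$ homeomorphic to the middle-third Cantor set. For $B\subset X$ with its subspace topology let $B^{(0)}=B$, let $B^{(\alpha+1)}$ be the set of non-isolated points of $B^{(\alpha)}$, and $B^{(\lambda)}=\bigcap_{\alpha<\lambda}B^{(\alpha)}$ for limit $\lambda$. The Cantor–Bendixson rank of $B$ is the least ordinal $\alpha$ with $B^{(\alpha+1)}=B^{(\alpha)}$ if $\bigcap_\alpha B^{(\alpha)}=\emptyset$, and it is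 $\infty$ (larger than every ordinal) if $\bigcap_\alpha B^{(\alpha)}\neq\emptyset$. The following conditions are equivalent: 1. there exists a Cantor set $A\subset X$ such that $\bigcup_{i=0}^{N} f^i(A)\in Q$ for all $N=1,2,\dots$; 2. there exists an uncountable, $f$-invariant, $\alpha_Q$-dependent subset of $X$; 3. for every countable ordinal $\gamma$ there exists an $f$-invariant, $\alpha_Q$-dependent set $B\subset X$ whose Cantor–Bendixson rank is not less than $\gamma$. -/

import Mathlib

open TopologicalSpace CantorBendixson

noncomputable section

namespace KuratowskiMycielski

universe u

variable {X : Type u} [TopologicalSpace X]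

/-- `SetMem Q S`: the set `S` is nonempty, compact and, as a point of the hyperspace `C(X)`
of nonempty compact subsets of `X`, belongs to `Q`. -/
def SetMem (Q : Set (NonemptyCompacts X)) (S : Set X) : Prop :=
  ∃ K ∈ Q, (K : Set X) = S

/-- `Q ⊆ C(X)` is hereditary if it contains every nonempty compact subset of each of its members. -/
def IsHereditary (Q : Set (NonemptyCompacts X)) : Prop :=
  ∀ K ∈ Q, ∀ L : NonemptyCompacts X, (L : Set X) ⊆ K → L ∈ Q

/-- The coherent list `α_Q` of `Q`: its `n`-th relation consists of the `n`-tuples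
`(x₁, …, xₙ)` with `{x₁, …, xₙ} ∈ Q`. -/
def coherentList (Q : Set (NonemptyCompacts X)) (n : ℕ) : Set (Fin n → X) :=
  {x | SetMem Q (Set.range x)}

/-- `A` is dependent for the sequence of relations `R₁, R₂, …`: for every `n ≥ 1`, all `n`-tuples
of pairwise distinct points of `A` lie in `Rₙ`. -/
def IsDependent (R : ∀ n : ℕ, Set (Fin n → X)) (A : Set X) : Prop :=
  ∀ n : ℕ, 1 ≤ n → ∀ x : Fin n → X, Function.Injective x → (∀ i, x i ∈ A) → x ∈ R n

/-- `A` is forward invariant: `f(A) ⊆ A`. -/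
def IsForwardInvariant (f : X → X) (A : Set X) : Prop :=
  f '' A ⊆ A

/-- A Cantor set: a subset homeomorphic to the middle-third Cantor set. -/
def IsCantor (A : Set X) : Prop :=
  Nonempty (A ≃ₜ cantorSet)

open Classical in
/-- The Cantor–Bendixson rank of a subset `B`, in its subspace topology. The derivatives `Bᵈ[α]`
are the iterated sets of non-isolated points. If they decrease to the empty set (`B` is
scattered), the rank is the least `α` at which they become stationary; if the perfect kernel is
nonempty, the rank is `⊤`, larger than every ordinal. -/
def cantorBendixsonRank (B : Set X) : WithTop Ordinal.{u} :=
  if perfectKernel B = ∅ then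
    ((sInf {α : Ordinal.{u} | Bᵈ[α + 1] = Bᵈ[α]} : Ordinal.{u}) : WithTop Ordinal.{u})
  else ⊤

end KuratowskiMycielski

end

open Set Filter Topology Metric Function

namespace KuratowskiMycielski

/-! The hard implication is 3 → 1. Requiring all finite orbit unions to lie in `Q` is again a
hereditary Gδ condition, so the dynamics is absorbed into the family. A perfect compact member
suffices, since it contains a Cantor set; perfectness follows from countably many open conditions
`nearbyPairs`. Compact members arise as limits of finite sets: a finite subset of the derivative of
stage `α` is approximated by finite subsets of stage `α` whose points have close companions. A
Baire-type construction keeps only open sets meeting every stage below `ω₁`, which is possible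
because countably many countable ordinals have a countable supremum. -/

/-- A decreasing `ω₁`-sequence of nonempty sets, each successor stage being approximated by the
points of the previous stage in each of the open sets `G n`, forces `⋂ n, G n` to be nonempty. -/
theorem nonempty_iInter_of_antitone_omega_one {Y : Type*} [MetricSpace Y] [CompleteSpace Y]
    [SecondCountableTopology Y] {G : ℕ → Set Y} (hG : ∀ n, IsOpen (G n))
    {E : Ordinal → Set Y} (hanti : Antitone E)
    (hne : ∀ α < Ordinal.omega 1, (E α).Nonempty)
    (hE : ∀ α n, E (α + 1) ⊆ closure (E α ∩ G n)) : (⋂ n, G n).Nonempty := by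
  let P : Set Y → Prop := fun V => IsOpen V ∧ ∀ α < Ordinal.omega 1, (V ∩ E α).Nonempty
  have step : ∀ (V : {V // P V}) (n : ℕ), ∃ W : {W // P W},
      closure W.1 ⊆ V.1 ∩ G n ∧ ∃ y, W.1 ⊆ closedBall y (1 / 2 ^ n) := by
    rintro ⟨V, hVo, hV⟩ n
    by_contra! hcon
    let b := TopologicalSpace.countableBasis Y
    let b' := {W : b // closure W.1 ⊆ V ∩ G n ∧ ∃ y, W.1 ⊆ closedBall y (1 / 2 ^ n)}
    have hb : ∀ W : b', ∃ α < Ordinal.omega 1, W.1.1 ∩ E α = ∅ := by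
      rintro ⟨⟨W, hW⟩, hW1, y, hW2⟩
      by_contra! h
      exact hcon ⟨W, TopologicalSpace.isOpen_of_mem_countableBasis hW, h⟩ hW1 y hW2
    choose a ha haE using hb
    -- Each admissible basic set misses some stage. One countable stage lies beyond all of these,
    -- and the next stage is approximated from it inside `G n`, which is the contradiction.
    have hβ : ⨆ W, a W < Ordinal.omega 1 := Ordinal.iSup_lt_omega_one ha
    have hβ' : (⨆ W, a W) + 1 < Ordinal.omega 1 :=
      (Cardinal.isSuccLimit_omega 1).add_one_lt hβ
    obtain ⟨y, hyV, hyE⟩ := hV _ hβ'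
    obtain ⟨z, hzV, hzE, hzG⟩ := mem_closure_iff.1 (hE _ n hyE) V hVo hyV
    have hU : V ∩ G n ∈ 𝓝 z := (hVo.inter (hG n)).mem_nhds ⟨hzV, hzG⟩
    obtain ⟨ε, hε, hεU⟩ := Metric.nhds_basis_closedBall.mem_iff.1 hU
    have hpos : 0 < min ε (1 / 2 ^ n) := lt_min hε (by positivity)
    obtain ⟨W, hWb, hzW, hWs⟩ := (TopologicalSpace.isBasis_countableBasis Y).mem_nhds_iff.1
      (closedBall_mem_nhds z hpos)
    have hWc : closure W ⊆ closedBall z (min ε (1 / 2 ^ n)) :=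
      closure_minimal hWs isClosed_closedBall
    let W' : b' := ⟨⟨W, hWb⟩, (hWc.trans (closedBall_subset_closedBall (min_le_left _ _))).trans hεU,
      z, hWs.trans (closedBall_subset_closedBall (min_le_right _ _))⟩
    have : z ∈ W'.1.1 ∩ E (a W') := by
      refine ⟨hzW, hanti ?_ hzE⟩
      exact le_ciSup (Ordinal.bddAbove_of_small) W'
    rw [haE W'] at this
    exact this
  choose next h1 c hc using step
  let V : ℕ → {V // P V} := fun n => Nat.rec ⟨univ, isOpen_univ, by simpa using hne⟩
    (fun n V => next V n) n
  have hVs : ∀ n, V (n + 1) = next (V n) n := fun n => rfl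
  have hVanti : Antitone fun n => closure (V n).1 := antitone_nat_of_succ_le fun n => by
    simp only [hVs]
    exact (h1 _ _).trans (inter_subset_left.trans subset_closure)
  have hsub : ∀ n, closure (V (n + 1)).1 ⊆ closedBall (c (V n) n) (1 / 2 ^ n) := fun n =>
    closure_minimal (hc _ _) isClosed_closedBall
  have hω : (0 : Ordinal) < Ordinal.omega 1 := Ordinal.omega_pos 1
  obtain ⟨y, hy⟩ : (⋂ n, closure (V (n + 1)).1).Nonempty := by
    refine nonempty_iInter_of_nonempty_biInter (fun _ => isClosed_closure)
      (fun n => isBounded_closedBall.subset (hsub n)) (fun N => ?_) ?_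
    · obtain ⟨y, hy, -⟩ := (V (N + 1)).2.2 0 hω
      exact ⟨y, mem_iInter₂.2 fun n hn => hVanti (Nat.succ_le_succ hn) (subset_closure hy)⟩
    · refine squeeze_zero (fun _ => diam_nonneg) (g := fun n : ℕ => 2 * (1 / 2) ^ n) (fun n => ?_) ?_
      · refine (diam_mono (hsub n) isBounded_closedBall).trans
          ((diam_closedBall (by positivity)).trans_eq ?_)
        simp
      · simpa using (tendsto_pow_atTop_nhds_zero_of_lt_one (r := (1 / 2 : ℝ)) (by norm_num)
          (by norm_num)).const_mul 2
  exact ⟨y, mem_iInter.2 fun n => (h1 _ _ (mem_iInter.1 hy n)).2⟩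

/-! ### Perfectness through open conditions on the hyperspace -/

section Perfect

variable {X : Type*} [MetricSpace X]

/-- The compact sets each of whose points has another point of the set within `ε`, uniformly. -/
def nearbyPairs (X : Type*) [MetricSpace X] (ε : ℝ) : Set (NonemptyCompacts X) :=
  {K | ∃ δ > 0, ∀ x ∈ K, ∃ y ∈ K, δ < dist x y ∧ dist x y < ε - δ}

theorem hausdorffEDist_ne_top (K L : NonemptyCompacts X) :
    hausdorffEDist (K : Set X) L ≠ ⊤ :=
  hausdorffEDist_ne_top_of_nonempty_of_bounded K.nonempty L.nonempty K.isCompact.isBounded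
    L.isCompact.isBounded

/-- The margin `δ` on both inequalities absorbs a Hausdorff perturbation, which moves both endpoints
of a pair. -/
theorem isOpen_nearbyPairs (ε : ℝ) : IsOpen (nearbyPairs X ε) := by
  refine Metric.isOpen_iff.2 fun K ⟨δ, hδ, hK⟩ => ⟨δ / 8, by positivity, fun L hL => ?_⟩
  rw [mem_ball, NonemptyCompacts.dist_eq] at hL
  refine ⟨δ / 2, by positivity, fun x hx => ?_⟩
  obtain ⟨x', hx', hxx'⟩ := exists_dist_lt_of_hausdorffDist_lt hx hL (hausdorffEDist_ne_top L K)
  obtain ⟨y', hy', h1, h2⟩ := hK x' hx'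
  obtain ⟨y, hy, hyy'⟩ := exists_dist_lt_of_hausdorffDist_lt' hy' hL (hausdorffEDist_ne_top L K)
  have h3 := dist_triangle4 x x' y' y
  have h4 := dist_triangle4 x' x y y'
  rw [dist_comm x' x] at h4
  rw [dist_comm y' y] at h3
  exact ⟨y, hy, by linarith, by linarith⟩

theorem mem_nearbyPairs_of_finite {K : NonemptyCompacts X} (hK : (K : Set X).Finite) {ε : ℝ}
    (h : ∀ x ∈ K, ∃ y ∈ K, y ≠ x ∧ dist x y < ε) : K ∈ nearbyPairs X ε := by
  choose! g hgK hg hgε using h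
  have : ∀ᶠ δ in 𝓝[>] (0 : ℝ), ∀ x ∈ (K : Set X), δ < dist x (g x) ∧ dist x (g x) < ε - δ := by
    refine (Filter.eventually_all_finite hK).2 fun x hx => nhdsWithin_le_nhds ?_
    filter_upwards [gt_mem_nhds (dist_pos.2 (hg x hx).symm),
      gt_mem_nhds (sub_pos.2 (hgε x hx))] with δ h1 h2
    exact ⟨h1, by linarith⟩
  obtain ⟨δ, hδ, hpos⟩ := (this.and self_mem_nhdsWithin).exists
  exact ⟨δ, hpos, fun x hx => ⟨g x, hgK x hx, hδ x hx⟩⟩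

theorem perfect_of_mem_nearbyPairs {K : NonemptyCompacts X}
    (h : ∀ n : ℕ, K ∈ nearbyPairs X (1 / (n + 1))) : Perfect (K : Set X) := by
  refine ⟨K.isCompact.isClosed, preperfect_iff_nhds.2 fun x hx U hU => ?_⟩
  obtain ⟨ε, hε, hεU⟩ := Metric.mem_nhds_iff.1 hU
  obtain ⟨n, hn⟩ := exists_nat_one_div_lt hε
  obtain ⟨δ, hδ, hK⟩ := h n
  obtain ⟨y, hy, h1, h2⟩ := hK x hx
  refine ⟨y, ⟨hεU ?_, hy⟩, ?_⟩
  · rw [mem_ball, dist_comm]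
    linarith
  · rintro rfl
    rw [dist_self] at h1
    linarith

/-- A finite set of points of the derivative of `D` can be enlarged, within a small Hausdorff
distance, by points of `D` so that each point has a distinct companion nearby. -/
theorem exists_finite_nearbyPairs {D : Set X} {F : NonemptyCompacts X} (hF : (F : Set X).Finite)
    (hFD : (F : Set X) ⊆ relDerivedSet D) {η ε : ℝ} (hη : 0 < η) (hε : 0 < ε) :
    ∃ L : NonemptyCompacts X, (L : Set X).Finite ∧ (L : Set X) ⊆ D ∧ dist L F < η ∧
      L ∈ nearbyPairs X ε := by
  have hpos : 0 < min (η / 2) ε := lt_min (by positivity) hε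
  have : ∀ x ∈ (F : Set X), ∃ y ∈ D, y ≠ x ∧ dist y x < min (η / 2) ε := by
    intro x hx
    obtain ⟨y, ⟨hy, hyD⟩, hyx⟩ := accPt_iff_nhds.1 (hFD hx).1 _ (ball_mem_nhds x hpos)
    exact ⟨y, hyD, hyx, hy⟩
  choose! g hgD hg hgd using this
  have hfin : ((F : Set X) ∪ g '' F).Finite := hF.union (hF.image g)
  let L : NonemptyCompacts X := ⟨⟨(F : Set X) ∪ g '' F, hfin.isCompact⟩, F.nonempty.inl⟩
  have hL : (L : Set X) = (F : Set X) ∪ g '' F := rfl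
  refine ⟨L, hfin, ?_, ?_, mem_nearbyPairs_of_finite hfin ?_⟩
  · rw [hL]
    exact union_subset (hFD.trans relDerivedSet_subset) (image_subset_iff.2 hgD)
  · rw [NonemptyCompacts.dist_eq]
    refine (hausdorffDist_le_of_mem_dist (r := η / 2) (by positivity) ?_ ?_).trans_lt (half_lt_self hη)
    · rintro x (hx | ⟨x, hx, rfl⟩)
      · exact ⟨x, hx, by rw [dist_self]; positivity⟩
      · exact ⟨x, hx, ((hgd x hx).trans_le (min_le_left _ _)).le⟩
    · exact fun x hx => ⟨x, Or.inl hx, by rw [dist_self]; positivity⟩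
  · rintro x (hx | ⟨x, hx, rfl⟩)
    · refine ⟨g x, Or.inr ⟨x, hx, rfl⟩, hg x hx, ?_⟩
      rw [dist_comm]
      exact (hgd x hx).trans_le (min_le_right _ _)
    · exact ⟨x, Or.inl hx, (hg x hx).symm, (hgd x hx).trans_le (min_le_right _ _)⟩

end Perfect

/-! ### Cantor–Bendixson rank and Cantor sets -/

variable {X : Type u} [TopologicalSpace X]

theorem subset_perfectKernel_of_preperfect {P B : Set X} (hP : Preperfect P) (h : P ⊆ B) :
    P ⊆ perfectKernel B := by
  refine subset_iInter fun i => ?_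
  simpa [iteratedDerivedSet_constant_iff_preperfect.mp hP i] using iteratedDerivedSet_mono h i

theorem iteratedDerivedSet_nonempty_of_lt_rank {B : Set X} {γ : Ordinal.{u}}
    (h : ((γ + 1 : Ordinal.{u}) : WithTop Ordinal.{u}) ≤ cantorBendixsonRank B) :
    (Bᵈ[γ]).Nonempty := by
  rw [cantorBendixsonRank] at h
  split_ifs at h with hB
  · rw [WithTop.coe_le_coe] at h
    by_contra hne
    rw [not_nonempty_iff_eq_empty] at hne
    have hmem : γ ∈ {α : Ordinal.{u} | Bᵈ[α + 1] = Bᵈ[α]} := by simp [hne]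
    exact absurd (h.trans (csInf_le' hmem)) (by simp)
  · exact (nonempty_iff_ne_empty.2 hB).mono (perfectKernel_subset_iteratedDerivedSet B γ)

/-- An uncountable subset of a second countable space contains a nonempty set without isolated
points. -/
theorem exists_preperfect_of_not_countable [SecondCountableTopology X] {B : Set X}
    (hB : ¬ B.Countable) : ∃ C ⊆ B, C.Nonempty ∧ Preperfect C := by
  let b := TopologicalSpace.countableBasis X
  -- The condensation points of `B` lying in `B`; only countably many points are lost.
  let C := {x ∈ B | ∀ U ∈ 𝓝 x, ¬ (U ∩ B).Countable}
  have hBC : (B \ C).Countable := by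
    have hc : (⋃ U ∈ {U ∈ b | (U ∩ B).Countable}, U ∩ B).Countable :=
      ((TopologicalSpace.countable_countableBasis X).mono (sep_subset _ _)).biUnion
        fun U hU => hU.2
    refine hc.mono fun x ⟨hx, hxC⟩ => ?_
    have : ∃ U ∈ 𝓝 x, (U ∩ B).Countable := by
      by_contra! h
      exact hxC ⟨hx, h⟩
    obtain ⟨U, hU, hUc⟩ := this
    obtain ⟨W, hWb, hxW, hWU⟩ := (TopologicalSpace.isBasis_countableBasis X).mem_nhds_iff.1 hU
    exact mem_biUnion (show W ∈ {U ∈ b | (U ∩ B).Countable} from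
      ⟨hWb, hUc.mono (inter_subset_inter_left _ hWU)⟩) ⟨hxW, hx⟩
  refine ⟨C, sep_subset _ _, ?_, preperfect_iff_nhds.2 fun x hx U hU => ?_⟩
  · by_contra h
    rw [not_nonempty_iff_eq_empty] at h
    rw [h, sdiff_empty] at hBC
    exact hB hBC
  · by_contra! h
    refine hx.2 U hU ((hBC.union (countable_singleton x)).mono fun y hy => ?_)
    by_cases hyC : y ∈ C
    · exact Or.inr (h y ⟨hy.1, hyC⟩)
    · exact Or.inl ⟨hy.2, hyC⟩

theorem cantorBendixsonRank_eq_top_of_not_countable [SecondCountableTopology X] {B : Set X}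
    (hB : ¬ B.Countable) : cantorBendixsonRank B = ⊤ := by
  obtain ⟨C, hCB, hne, hC⟩ := exists_preperfect_of_not_countable hB
  rw [cantorBendixsonRank, if_neg]
  exact (hne.mono (subset_perfectKernel_of_preperfect hC hCB)).ne_empty

theorem IsHereditary.exists_isCantor_of_perfect [PolishSpace X] {Q : Set (NonemptyCompacts X)}
    (hQ : IsHereditary Q) {K : NonemptyCompacts X} (hK : K ∈ Q) (hP : Perfect (K : Set X)) :
    ∃ A ∈ Q, IsCantor (A : Set X) := by
  let := TopologicalSpace.upgradeIsCompletelyMetrizable X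
  obtain ⟨g, hgK, hg, hgi⟩ := hP.exists_nat_bool_injection K.nonempty
  refine ⟨⟨⟨range g, isCompact_range hg⟩, range_nonempty g⟩, hQ K hK _ hgK, ⟨?_⟩⟩
  exact ((hg.isClosedEmbedding hgi).isEmbedding.toHomeomorph.symm).trans
    cantorSetHomeomorphNatToBool.symm

/-- A hereditary `Gδ` family of compact sets contains a Cantor set as soon as there are sets of
arbitrarily large countable rank all of whose nonempty finite subsets belong to the family. -/
theorem exists_isCantor_of_rank [PolishSpace X] {Q : Set (NonemptyCompacts X)}
    (hQ : IsGδ Q) (hQ' : IsHereditary Q)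
    (h : ∀ γ : Ordinal.{u}, γ < Ordinal.omega 1 → ∃ B : Set X,
      (∀ F : NonemptyCompacts X, (F : Set X).Finite → (F : Set X) ⊆ B → F ∈ Q) ∧
      (γ : WithTop Ordinal.{u}) ≤ cantorBendixsonRank B) :
    ∃ A ∈ Q, IsCantor (A : Set X) := by
  let := TopologicalSpace.upgradeIsCompletelyMetrizable X
  obtain ⟨U, hU, rfl⟩ := hQ.eq_iInter_nat
  -- The witness `B` is chosen inside `E α`, since it may change with `α`.
  let E : Ordinal.{u} → Set (NonemptyCompacts X) := fun α => {F | (F : Set X).Finite ∧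
    ∃ B : Set X, (∀ F : NonemptyCompacts X, (F : Set X).Finite → (F : Set X) ⊆ B →
      F ∈ ⋂ n, U n) ∧ (F : Set X) ⊆ Bᵈ[α]}
  have hne : (⋂ n : ℕ, U n ∩ nearbyPairs X (1 / (n + 1))).Nonempty := by
    refine nonempty_iInter_of_antitone_omega_one (E := E)
      (fun n => (hU n).inter (isOpen_nearbyPairs _)) ?_ ?_ ?_
    · rintro α β hαβ F ⟨hF, B, hB, hFB⟩
      exact ⟨hF, B, hB, hFB.trans (iteratedDerivedSet_antitone B hαβ)⟩
    · intro α hα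
      obtain ⟨B, hB, hr⟩ := h (α + 1) ((Cardinal.isSuccLimit_omega 1).add_one_lt hα)
      obtain ⟨x, hx⟩ := iteratedDerivedSet_nonempty_of_lt_rank hr
      exact ⟨{x}, by simp, B, hB, by simpa using hx⟩
    · rintro α n F ⟨hF, B, hB, hFB⟩
      rw [iteratedDerivedSet_succ] at hFB
      refine Metric.mem_closure_iff.2 fun η hη => ?_
      obtain ⟨L, hL, hLD, hd, hp⟩ := exists_finite_nearbyPairs hF hFB hη
        (ε := 1 / (n + 1)) (by positivity)
      rw [dist_comm] at hd
      refine ⟨L, ⟨⟨hL, B, hB, hLD⟩, ?_, hp⟩, hd⟩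
      exact mem_iInter.1 (hB L hL (hLD.trans (by
        simpa using iteratedDerivedSet_antitone B (zero_le (a := α))))) n
  obtain ⟨K, hK⟩ := hne
  rw [mem_iInter] at hK
  exact hQ'.exists_isCantor_of_perfect (mem_iInter.2 fun n => (hK n).1)
    (perfect_of_mem_nearbyPairs fun n => (hK n).2)

/-! ### Orbit unions and the equivalence -/

variable {f : X → X}

/-- The union of the first `N + 1` iterated images of a nonempty compact set. -/
def orbitUnion (hf : Continuous f) : ℕ → NonemptyCompacts X → NonemptyCompacts X
  | 0, K => K
  | N + 1, K => orbitUnion hf N K ⊔ K.map (f^[N + 1]) (hf.iterate _)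

theorem coe_orbitUnion (hf : Continuous f) (N : ℕ) (K : NonemptyCompacts X) :
    (orbitUnion hf N K : Set X) = ⋃ i ∈ Finset.range (N + 1), f^[i] '' K := by
  induction N with
  | zero => simp [orbitUnion]
  | succ N ih =>
    rw [orbitUnion, NonemptyCompacts.coe_sup, ih, NonemptyCompacts.coe_map,
      Finset.range_add_one (n := N + 1), Finset.set_biUnion_insert, union_comm]

theorem continuous_orbitUnion (hf : Continuous f) (N : ℕ) : Continuous (orbitUnion hf N) := by
  induction N with
  | zero => exact continuous_id
  | succ N ih => exact ih.sup (hf.iterate _).nonemptyCompacts_map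

theorem orbitUnion_mono (hf : Continuous f) (N : ℕ) {K L : NonemptyCompacts X}
    (h : (K : Set X) ⊆ L) : (orbitUnion hf N K : Set X) ⊆ orbitUnion hf N L := by
  simp only [coe_orbitUnion]
  exact biUnion_mono subset_rfl fun i _ => image_mono h

theorem IsForwardInvariant.orbitUnion_subset {B : Set X} (hB : IsForwardInvariant f B)
    (hf : Continuous f) (N : ℕ) {K : NonemptyCompacts X} (h : (K : Set X) ⊆ B) :
    (orbitUnion hf N K : Set X) ⊆ B := by
  rw [coe_orbitUnion]
  have hmaps : MapsTo f B B := mapsTo_iff_image_subset.2 hB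
  exact iUnion₂_subset fun i _ => ((hmaps.iterate i).mono_left h).image_subset

theorem IsDependent.mem_of_finite {Q : Set (NonemptyCompacts X)} {B : Set X}
    (hB : IsDependent (coherentList Q) B) {F : NonemptyCompacts X} (hF : (F : Set X).Finite)
    (hFB : (F : Set X) ⊆ B) : F ∈ Q := by
  obtain ⟨n, x, hx, hr⟩ := hF.fin_param
  have hn : 1 ≤ n := by
    rcases Nat.eq_zero_or_pos n with rfl | hn
    · have := F.nonempty
      rw [← hr] at this
      exact absurd this (by simp)
    · exact hn
  obtain ⟨K, hK, hKF⟩ := hB n hn x hx fun i => hFB (hr ▸ mem_range_self i)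
  rwa [← SetLike.coe_injective (hKF.trans hr)]

end KuratowskiMycielski

open KuratowskiMycielski in
theorem corollary2p5 {X : Type*} [TopologicalSpace X] [PolishSpace X]
    (f : X → X) (hf : Continuous f)
    (Q : Set (NonemptyCompacts X)) (hQ : IsGδ Q) (hQ' : KuratowskiMycielski.IsHereditary Q) :
    List.TFAE
      [∃ A : Set X, KuratowskiMycielski.IsCantor A ∧
        ∀ N : ℕ, 1 ≤ N →
          KuratowskiMycielski.SetMem Q (⋃ i ∈ Finset.range (N + 1), f^[i] '' A),
      ∃ B : Set X, ¬ B.Countable ∧ KuratowskiMycielski.IsForwardInvariant f B ∧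
        KuratowskiMycielski.IsDependent (KuratowskiMycielski.coherentList Q) B,
      ∀ γ : Ordinal, γ < Ordinal.omega 1 →
        ∃ B : Set X, KuratowskiMycielski.IsForwardInvariant f B ∧
          KuratowskiMycielski.IsDependent (KuratowskiMycielski.coherentList Q) B ∧
          (γ : WithTop Ordinal) ≤ KuratowskiMycielski.cantorBendixsonRank B] := by
  tfae_have 1 → 2 := by
    rintro ⟨A, ⟨e⟩, hA⟩
    refine ⟨⋃ i : ℕ, f^[i] '' A, fun hc => ?_, ?_, fun n hn x _ hxA => ?_⟩
    · have : Countable A := (hc.mono (subset_iUnion (fun i : ℕ => f^[i] '' A) 0) |>.mono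
        (by simp : A ⊆ f^[0] '' A)).to_subtype
      have : Countable (ℕ → Bool) := (e.trans cantorSetHomeomorphNatToBool).symm.injective.countable
      -- Cantor's diagonal argument.
      obtain ⟨g, hg⟩ := exists_surjective_nat (ℕ → Bool)
      obtain ⟨n, hn⟩ := hg fun n => !g n n
      simpa using congrFun hn n
    · rintro _ ⟨_, hx, rfl⟩
      obtain ⟨i, a, ha, rfl⟩ := mem_iUnion.1 hx
      exact mem_iUnion.2 ⟨i + 1, a, ha, iterate_succ_apply' f i a⟩
    · choose i hi using fun k => mem_iUnion.1 (hxA k)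
      let N := Finset.univ.sup i + 1
      obtain ⟨K, hK, hKA⟩ := hA N (Nat.le_add_left _ _)
      have : Nonempty (Fin n) := ⟨⟨0, hn⟩⟩
      refine ⟨⟨⟨range x, (finite_range x).isCompact⟩, range_nonempty x⟩, hQ' K hK _ ?_, rfl⟩
      rw [hKA]
      rintro _ ⟨k, rfl⟩
      refine mem_biUnion (x := i k) (Finset.mem_coe.2 (Finset.mem_range.2 ?_)) (hi k)
      have := Finset.le_sup (f := i) (Finset.mem_univ k)
      omega
  tfae_have 2 → 3 := by
    rintro ⟨B, hB, hinv, hdep⟩ γ -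
    exact ⟨B, hinv, hdep, by simp [cantorBendixsonRank_eq_top_of_not_countable hB]⟩
  tfae_have 3 → 1 := by
    intro h
    -- The rank criterion is applied to the compact sets with all orbit unions in `Q`; invariance
    -- keeps the orbit unions of finite subsets of `B` finite and inside `B`.
    have hex : ∃ A ∈ ⋂ N, orbitUnion hf N ⁻¹' Q, IsCantor (A : Set X) := by
      refine exists_isCantor_of_rank
        (IsGδ.iInter fun N => hQ.preimage (continuous_orbitUnion hf N)) (fun K hK L hLK => ?_)
        (fun γ hγ => ?_)
      · exact mem_iInter.2 fun N => hQ' _ (mem_iInter.1 hK N) _ (orbitUnion_mono hf N hLK)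
      · obtain ⟨B, hinv, hdep, hr⟩ := h γ hγ
        refine ⟨B, fun F hF hFB => mem_iInter.2 fun N => hdep.mem_of_finite ?_
          (hinv.orbitUnion_subset hf N hFB), hr⟩
        rw [coe_orbitUnion]
        exact (Finset.finite_toSet _).biUnion fun i _ => hF.image _
    obtain ⟨A, hA, hAc⟩ := hex
    exact ⟨A, hAc, fun N _ => ⟨orbitUnion hf N A, mem_iInter.1 hA N, coe_orbitUnion hf N A⟩⟩
  tfae_finish
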